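/- Let $\tau=\{R\}$ be the vocabulary consisting of a single ternary relation symbol $R$ (no constants, no function symbols, no other relation symbols; equality is available as a logical symbol). For a first-order $\tau$-sentence $\phi$ let $$Sp_\phi(n)=\bigl|\{A\subseteq [n]^3 : ([n],A)\models\phi\}\bigr|$$ be the number of $\tau$-structures with universe $[n]=\{1,\dots,n\}$ that satisfy $\phi$. Then there is a first-order $\tau$-sentence $\phi$ such that the sequence $Sp_\phi(n)$ is not ultimately periodic modulo $2$, that is, there are no $p\ge 1$ and $N$ with $Sp_\phi(n+p)\equiv Sp_\phi(n)\pmod 2$ for all $n\ge N$. Moreover $Sp_\phi$ is not MC-finite: it is not the case that for every integer $m\ge 1$ there are $r,k\in\mathbb{N}$ and integers $\alpha_0,\dots,\alpha_{k-1}$ with $$Sp_\phi(n+k)\equiv\sum_{i=0}^{k-1}\alpha_i\,Sp_\phi(n+i)\pmod m\qquad\text{for all } n\ge r .$$ Hence the conclusion of the Specker–Blatter theorem (MC-finiteness of the counting function) fails already for one ternary relation, even for first-order sentences. -/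

import Mathlib

/-- The relation symbols of the vocabulary: a single symbol `R`, of arity `3`. -/
inductive TernaryRel : ℕ → Type
  | R : TernaryRel 3

/-- The first-order vocabulary with one ternary relation symbol and nothing else
(no constants, no function symbols, no other relation symbols). -/
def ternaryLanguage : FirstOrder.Language.{0, 0} where
  Functions := fun _ => Empty
  Relations := TernaryRel

/-- The structure `(M, A)` in which the ternary relation symbol is interpreted by the set of
triples `A ⊆ M³`. -/
abbrev ternaryStructure {M : Type} (A : Set (Fin 3 → M)) : ternaryLanguage.Structure M where
  funMap := fun f _ => Empty.elim f
  RelMap := fun r x =>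
    match r, x with
    | TernaryRel.R, x => x ∈ A

/-- The counting function `Sp_φ(n) = |{A ⊆ [n]³ : ([n], A) ⊨ φ}|` of a first-order sentence `φ`
(labelled structures, not isomorphism classes), with `Fin n` as the `n`-element universe. -/
noncomputable def countingFunction (φ : ternaryLanguage.Sentence) (n : ℕ) : ℕ :=
  Set.ncard {A : Set (Fin 3 → Fin n) |
    @FirstOrder.Language.Sentence.Realize ternaryLanguage (Fin n) (ternaryStructure A) φ}

/-- The sequence `s`, reduced modulo `m`, is ultimately periodic. -/
def UltimatelyPeriodicMod (m : ℕ) (s : ℕ → ℕ) : Prop :=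
  ∃ p N : ℕ, 0 < p ∧ ∀ n ≥ N, s (n + p) ≡ s n [MOD m]

/-- MC-finite (modularly C-finite) sequences: for each `m ≥ 1` separately there is a linear
recurrence with constant coefficients that `s` satisfies modulo `m`, from some index `r` on. -/
def MCFinite (s : ℕ → ℕ) : Prop :=
  ∀ m : ℕ, 0 < m → ∃ (r : ℕ) (E : LinearRecurrence (ZMod m)),
    E.IsSolution fun n => (s (r + n) : ZMod m)

open FirstOrder Language

/-! View the universe of size `2 ^ k` as the leaves of the full binary tree of height `k`. The tree
automorphisms form a 2-group (`isPGroup_isometries`) acting on the models, so the count modulo 2 is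
the number of invariant models.

The sentence makes every triple of distinct points single out one of them, its apex. An automorphism
swapping two close leaves and fixing a third forces the apex in an invariant model to be that of the
tree (`IsPascalTree.describesTree`). The sentence can then compare distances from a leaf. For a
triple with `dist x y < dist x z`, the bit `R x y z` remains; the Pascal rule makes it the parity of
`(dist x z).choose (dist x y)` (`IsPascalTree.rel_iff_odd`). The condition on the last row says that
`k.choose j` is even for `0 < j < k`. Hence there is one invariant model if this holds and none
otherwise (`odd_countingFunction_iff`).

The count at `2 ^ k` is thus odd for `k = 2 ^ m`, but even for `k = 2 ^ m + r` with `0 < r < 2 ^ m`.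
For a suitable fixed `r` a period would identify these two parities. A recurrence modulo 2 would
give a period, so MC-finiteness fails too. -/

namespace TernaryTree

/-! ### The axioms on a ternary relation. -/

section Semantics

variable {M : Type}

/-- The pair `x, y` is singled out against `z`. -/
def Apex (R : M → M → M → Prop) (z x y : M) : Prop := R z x y ∧ R z y x

/-- Seen from `x`, the level of `z` immediately follows the level of `y`. -/
def Succ (R : M → M → M → Prop) (x y z : M) : Prop :=
  Apex R z x y ∧ ∀ w, ¬(Apex R w x y ∧ Apex R z x w)

/-- The meaning of the sentence `pascalSentence`. -/
structure IsPascalTree (R : M → M → M → Prop) : Prop where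
  degenerate : ∀ x y, ¬R x x y ∧ ¬R x y x ∧ ¬R y x x
  exists_apex : ∀ x y z, ¬x = y → ¬y = z → ¬x = z → Apex R x y z ∨ Apex R y x z ∨ Apex R z x y
  not_rel_of_apex : ∀ x y z, Apex R x y z → ¬R y x z
  pascal : ∀ x i' i j, Succ R x i' i → Apex R i x j →
    (R x j i ↔ ¬((∀ j', Succ R x j' j → R x j' i') ↔ (Apex R i' x j → R x j i')))
  last_row : ∀ x i, (∀ w, ¬Apex R w x i) → ∀ j, Apex R i x j → ¬R x j i

/-- The relation of a set of triples. -/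
def rel (A : Set (Fin 3 → M)) (x y z : M) : Prop := ![x, y, z] ∈ A

end Semantics

/-! ### The axioms as a first-order sentence. -/

section Formulas

variable {n : ℕ}

def relF (a b c : Fin n) : ternaryLanguage.BoundedFormula Empty n :=
  Relations.boundedFormula (L := ternaryLanguage) (n := 3) TernaryRel.R
    ![Term.var (Sum.inr a), Term.var (Sum.inr b), Term.var (Sum.inr c)]

def eqF (a b : Fin n) : ternaryLanguage.BoundedFormula Empty n :=
  Term.bdEqual (Term.var (Sum.inr a)) (Term.var (Sum.inr b))

def apexF (z x y : Fin n) : ternaryLanguage.BoundedFormula Empty n := relF z x y ⊓ relF z y x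

/-- Universal quantification over a fresh variable. -/
def allF (f : Fin (n + 1) → ternaryLanguage.BoundedFormula Empty (n + 1)) :
    ternaryLanguage.BoundedFormula Empty n := (f (Fin.last n)).all

def succF (x y z : Fin n) : ternaryLanguage.BoundedFormula Empty n :=
  apexF z x y ⊓ allF fun w =>
    (apexF w x.castSucc y.castSucc ⊓ apexF z.castSucc x.castSucc w).not

def degenerateF : ternaryLanguage.Sentence :=
  allF fun x => allF fun y =>
    (relF x.castSucc x.castSucc y).not ⊓
      ((relF x.castSucc y x.castSucc).not ⊓ (relF y x.castSucc x.castSucc).not)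

def existsApexF : ternaryLanguage.Sentence :=
  allF fun x => allF fun y => allF fun z =>
    (eqF x.castSucc.castSucc y.castSucc).not.imp
      ((eqF y.castSucc z).not.imp ((eqF x.castSucc.castSucc z).not.imp
        (apexF x.castSucc.castSucc y.castSucc z ⊔
          (apexF y.castSucc x.castSucc.castSucc z ⊔ apexF z x.castSucc.castSucc y.castSucc))))

def notRelF : ternaryLanguage.Sentence :=
  allF fun x => allF fun y => allF fun z =>
    (apexF x.castSucc.castSucc y.castSucc z).imp (relF y.castSucc x.castSucc.castSucc z).not

def recursionF (x i' i j : Fin n) : ternaryLanguage.BoundedFormula Empty n :=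
  (succF x i' i).imp ((apexF i x j).imp
    ((relF x j i).iff
      ((allF fun j' => (succF x.castSucc j' j.castSucc).imp
          (relF x.castSucc j' i'.castSucc)).iff
        ((apexF i' x j).imp (relF x j i'))).not))

def pascalF : ternaryLanguage.Sentence :=
  allF fun x => allF fun i' => allF fun i => allF fun j =>
    recursionF x.castSucc.castSucc.castSucc i'.castSucc.castSucc i.castSucc j

def lastRowF : ternaryLanguage.Sentence :=
  allF fun x => allF fun i =>
    (allF fun w => (apexF w x.castSucc.castSucc i.castSucc).not).imp
      (allF fun j => (apexF i.castSucc x.castSucc.castSucc j).imp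
        (relF x.castSucc.castSucc j i.castSucc).not)

/-- The first-order sentence expressing `IsPascalTree`. -/
def pascalSentence : ternaryLanguage.Sentence :=
  degenerateF ⊓ (existsApexF ⊓ (notRelF ⊓ (pascalF ⊓ lastRowF)))

end Formulas

/-! ### Correctness of the formalized sentence. -/

section Realize

variable {M : Type} {n : ℕ} {A : Set (Fin 3 → M)}

/-- Realization in the structure given by `A`. -/
def Sat (A : Set (Fin 3 → M)) (φ : ternaryLanguage.BoundedFormula Empty n) (xs : Fin n → M) :
    Prop :=
  let := ternaryStructure A
  φ.Realize default xs

@[simp] lemma sat_not (φ : ternaryLanguage.BoundedFormula Empty n) (xs : Fin n → M) :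
    Sat A φ.not xs ↔ ¬Sat A φ xs := by
  let := ternaryStructure A
  exact BoundedFormula.realize_not

@[simp] lemma sat_imp (φ ψ : ternaryLanguage.BoundedFormula Empty n) (xs : Fin n → M) :
    Sat A (φ.imp ψ) xs ↔ (Sat A φ xs → Sat A ψ xs) := by
  let := ternaryStructure A
  exact BoundedFormula.realize_imp

@[simp] lemma sat_inf (φ ψ : ternaryLanguage.BoundedFormula Empty n) (xs : Fin n → M) :
    Sat A (φ ⊓ ψ) xs ↔ (Sat A φ xs ∧ Sat A ψ xs) := by
  let := ternaryStructure A
  exact BoundedFormula.realize_inf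

@[simp] lemma sat_sup (φ ψ : ternaryLanguage.BoundedFormula Empty n) (xs : Fin n → M) :
    Sat A (φ ⊔ ψ) xs ↔ (Sat A φ xs ∨ Sat A ψ xs) := by
  let := ternaryStructure A
  exact BoundedFormula.realize_sup

@[simp] lemma sat_iff (φ ψ : ternaryLanguage.BoundedFormula Empty n) (xs : Fin n → M) :
    Sat A (φ.iff ψ) xs ↔ (Sat A φ xs ↔ Sat A ψ xs) := by
  let := ternaryStructure A
  exact BoundedFormula.realize_iff

@[simp] lemma sat_allF (f : Fin (n + 1) → ternaryLanguage.BoundedFormula Empty (n + 1))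
    (xs : Fin n → M) :
    Sat A (allF f) xs ↔ ∀ a, Sat A (f (Fin.last n)) (Fin.snoc (α := fun _ => M) xs a) := by
  let := ternaryStructure A
  exact BoundedFormula.realize_all

@[simp] lemma sat_relF (a b c : Fin n) (xs : Fin n → M) :
    Sat A (relF a b c) xs ↔ rel A (xs a) (xs b) (xs c) := by
  let := ternaryStructure A
  refine BoundedFormula.realize_rel.trans ?_
  have : (fun i => Term.realize (L := ternaryLanguage) (Sum.elim (default : Empty → M) xs)
      (![Term.var (Sum.inr a), Term.var (Sum.inr b), Term.var (Sum.inr c)] i)) =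
      ![xs a, xs b, xs c] := by
    funext i
    fin_cases i <;> rfl
  rw [this]
  rfl

@[simp] lemma sat_eqF (a b : Fin n) (xs : Fin n → M) : Sat A (eqF a b) xs ↔ xs a = xs b := by
  let := ternaryStructure A
  exact BoundedFormula.realize_bdEqual _ _

@[simp] lemma sat_apexF (a b c : Fin n) (xs : Fin n → M) :
    Sat A (apexF a b c) xs ↔ Apex (rel A) (xs a) (xs b) (xs c) := by
  simp [apexF, Apex]

@[simp] lemma sat_succF (a b c : Fin n) (xs : Fin n → M) :
    Sat A (succF a b c) xs ↔ Succ (rel A) (xs a) (xs b) (xs c) := by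
  simp only [succF, Succ, sat_inf, sat_allF, sat_not, sat_apexF, Fin.snoc_castSucc, Fin.snoc_last]

lemma sat_recursionF (x i' i j : Fin n) (xs : Fin n → M) :
    Sat A (recursionF x i' i j) xs ↔
      (Succ (rel A) (xs x) (xs i') (xs i) → Apex (rel A) (xs i) (xs x) (xs j) →
        (rel A (xs x) (xs j) (xs i) ↔
          ¬((∀ j', Succ (rel A) (xs x) j' (xs j) → rel A (xs x) j' (xs i')) ↔
            (Apex (rel A) (xs i') (xs x) (xs j) → rel A (xs x) (xs j) (xs i'))))) := by
  simp only [recursionF, sat_imp, sat_iff, sat_succF, sat_apexF, sat_relF, sat_not, sat_allF,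
    Fin.snoc_castSucc, Fin.snoc_last]

lemma realize_pascalSentence (A : Set (Fin 3 → M)) :
    @Sentence.Realize ternaryLanguage M (ternaryStructure A) pascalSentence ↔
      IsPascalTree (rel A) := by
  change Sat A pascalSentence default ↔ _
  simp only [pascalSentence, degenerateF, existsApexF, notRelF, pascalF, lastRowF,
    sat_recursionF, sat_imp, sat_inf, sat_sup, sat_apexF, sat_relF, sat_eqF, sat_not,
    sat_allF, Fin.snoc_castSucc, Fin.snoc_last]
  exact ⟨fun ⟨h₁, h₂, h₃, h₄, h₅⟩ => ⟨h₁, h₂, h₃, h₄, h₅⟩,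
    fun ⟨h₁, h₂, h₃, h₄, h₅⟩ => ⟨h₁, h₂, h₃, h₄, h₅⟩⟩

end Realize

/-! ### The ultrametric on the leaves of the binary tree. -/

section Distance

variable {k : ℕ}

/-- The height of the lowest common ancestor of two leaves of the full binary tree. -/
def dist (x y : Fin (2 ^ k)) : ℕ := Nat.size (x.val ^^^ y.val)

lemma dist_comm (x y : Fin (2 ^ k)) : dist x y = dist y x := by
  rw [dist, Nat.xor_comm, dist]

@[simp] lemma dist_self (x : Fin (2 ^ k)) : dist x x = 0 := by simp [dist]

lemma dist_eq_zero {x y : Fin (2 ^ k)} : dist x y = 0 ↔ x = y := by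
  rw [dist, Nat.size_eq_zero, Nat.xor_eq_zero_iff, Fin.ext_iff]

lemma dist_pos {x y : Fin (2 ^ k)} : 0 < dist x y ↔ x ≠ y := by
  rw [Nat.pos_iff_ne_zero, Ne, dist_eq_zero]

lemma dist_le_iff {x y : Fin (2 ^ k)} {r : ℕ} : dist x y ≤ r ↔ x.val ^^^ y.val < 2 ^ r :=
  Nat.size_le

lemma dist_le (x y : Fin (2 ^ k)) : dist x y ≤ k :=
  dist_le_iff.2 (Nat.xor_lt_two_pow x.2 y.2)

lemma xor_eq (x y z : ℕ) : x ^^^ z = (x ^^^ y) ^^^ (y ^^^ z) := by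
  rw [Nat.xor_assoc, ← Nat.xor_assoc y, Nat.xor_self, Nat.zero_xor]

lemma dist_trans {x y z : Fin (2 ^ k)} {r : ℕ} (hxy : dist x y ≤ r) (hyz : dist y z ≤ r) :
    dist x z ≤ r := by
  rw [dist_le_iff] at *
  rw [xor_eq x.val y.val z.val]
  exact Nat.xor_lt_two_pow hxy hyz

lemma testBit_of_size {a r : ℕ} (h : Nat.size a = r + 1) : a.testBit r = true := by
  have h₁ : a < 2 ^ (r + 1) := Nat.size_le.1 h.le
  have h₂ : 2 ^ r ≤ a := Nat.lt_size.1 (by omega)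
  exact Nat.testBit_of_two_pow_le_and_two_pow_add_one_gt h₂ h₁

/-- Every node of the tree has only two children. -/
lemma dist_lt_of_eq {x y z : Fin (2 ^ k)} (hxy : x ≠ y) (h : dist x y = dist x z) :
    dist y z < dist x y := by
  obtain ⟨r, hr⟩ := Nat.exists_eq_succ_of_ne_zero (dist_pos.2 hxy).ne'
  rw [dist_comm] at hr
  have hr' : dist x z = r + 1 := by rw [← h, dist_comm, hr]
  rw [dist_comm x y, hr, Nat.succ_eq_add_one, Nat.lt_succ_iff, dist_le_iff]
  have h₁ := testBit_of_size hr
  have h₂ := testBit_of_size hr'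
  have h₃ : y.val ^^^ z.val < 2 ^ (r + 1) := dist_le_iff.1 (dist_trans hr.le hr'.le)
  by_contra h₄
  have h₅ := Nat.testBit_of_two_pow_le_and_two_pow_add_one_gt (not_lt.1 h₄) h₃
  rw [xor_eq y.val x.val z.val, Nat.testBit_xor, h₁, h₂] at h₅
  simp at h₅

lemma dist_eq_of_lt {x y z : Fin (2 ^ k)} (h : dist x y < dist x z) : dist y z = dist x z := by
  apply le_antisymm
  · exact dist_trans (y := x) (by rw [dist_comm]; exact h.le) le_rfl
  · by_contra! h'
    rcases le_total (dist x y) (dist y z) with h₁ | h₁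
    · exact absurd (dist_trans h₁ le_rfl) (not_le.2 h')
    · exact absurd (dist_trans le_rfl h₁) (not_le.2 h)

lemma dist_trichotomy {x y : Fin (2 ^ k)} (z : Fin (2 ^ k)) (hxy : x ≠ y) :
    dist x y < dist x z ∨ dist y z < dist y x ∨ dist x z < dist x y := by
  rcases lt_trichotomy (dist x y) (dist x z) with h | h | h
  · exact Or.inl h
  · exact Or.inr (Or.inl (by rw [dist_comm y x]; exact dist_lt_of_eq hxy h))
  · exact Or.inr (Or.inr h)

lemma exists_dist_eq (x : Fin (2 ^ k)) {i : ℕ} (hi : i ≤ k) : ∃ y, dist x y = i := by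
  rcases Nat.eq_zero_or_pos i with rfl | hpos
  · exact ⟨x, dist_self x⟩
  · obtain ⟨j, rfl⟩ := Nat.exists_eq_succ_of_ne_zero hpos.ne'
    refine ⟨⟨x.val ^^^ 2 ^ j, Nat.xor_lt_two_pow x.2 (Nat.pow_lt_pow_right (by norm_num) hi)⟩, ?_⟩
    simp [dist, Nat.size_pow]

end Distance

/-! ### Tree automorphisms form a 2-group. -/

section Isometries

variable {k : ℕ}

/-- The automorphism group of the full binary tree, acting on the leaves. -/
def isometries (k : ℕ) : Subgroup (Equiv.Perm (Fin (2 ^ k))) where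
  carrier := {g | ∀ x y, dist (g x) (g y) = dist x y}
  mul_mem' := fun {a b} ha hb x y => by
    rw [Equiv.Perm.mul_apply, Equiv.Perm.mul_apply, ha, hb]
  one_mem' := fun _ _ => rfl
  inv_mem' := fun {a} ha x y => by
    rw [← ha (a⁻¹ x) (a⁻¹ y)]
    simp

/-- Each squaring gains a level: `x` and `h (h x)` are equally far from `h x`, so, the tree being
binary, they are strictly closer to each other. -/
lemma dist_pow_le {g : Equiv.Perm (Fin (2 ^ k))} (hg : g ∈ isometries k) (i : ℕ)
    (x : Fin (2 ^ k)) : dist x ((g ^ 2 ^ i) x) ≤ k - i := by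
  induction i generalizing x with
  | zero => exact dist_le _ _
  | succ i ih =>
    set h := g ^ 2 ^ i with hh
    have hmem : h ∈ isometries k := pow_mem hg _
    have hsq : g ^ 2 ^ (i + 1) = h * h := by rw [hh, ← pow_add, pow_succ, mul_two]
    rw [hsq, Equiv.Perm.mul_apply]
    have h₁ : dist (h x) (h (h x)) = dist x (h x) := hmem _ _
    rcases lt_or_eq_of_le (ih x) with h₂ | h₂
    · exact dist_trans (y := h x) (by omega) (by omega)
    · rcases eq_or_ne x (h x) with h₃ | h₃
      · rw [← h₃, ← h₃, dist_self]; exact Nat.zero_le _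
      · have := dist_lt_of_eq (x := h x) (y := x) (z := h (h x)) h₃.symm
          (by rw [h₁, dist_comm])
        rw [dist_comm (h x)] at this
        omega

lemma isPGroup_isometries (k : ℕ) : IsPGroup 2 (isometries k) := fun g => by
  refine ⟨k, Subtype.ext (Equiv.ext fun x => ?_)⟩
  have := dist_pow_le g.2 k x
  rw [Nat.sub_self, Nat.le_zero, dist_eq_zero] at this
  exact this.symm

/-- Two leaves are exchanged by an automorphism that moves only leaves close to them. -/
lemma exists_isometry_swap (x y : Fin (2 ^ k)) :
    ∃ g ∈ isometries k, g x = y ∧ g y = x ∧ ∀ z, dist x y < dist x z → g z = z := by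
  set c := x.val ^^^ y.val with hc
  have hlt : ∀ w : Fin (2 ^ k), w.val ^^^ c < 2 ^ k := fun w =>
    Nat.xor_lt_two_pow w.2 (Nat.xor_lt_two_pow x.2 y.2)
  let t : Fin (2 ^ k) → Fin (2 ^ k) := fun w => ⟨w.val ^^^ c, hlt w⟩
  have htt : ∀ w, t (t w) = w := fun w => Fin.ext (by simp [t])
  have htd : ∀ w, dist w (t w) = dist x y := fun w => by
    simp [t, dist, ← Nat.xor_assoc, hc]
  have htiso : ∀ v w, dist (t v) (t w) = dist v w := fun v w => by
    have : (v.val ^^^ c) ^^^ (w.val ^^^ c) = v.val ^^^ w.val := by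
      rw [Nat.xor_comm w.val c, ← xor_eq]
    simp only [t, dist, this]
  have htx : t x = y := Fin.ext (by simp [t, hc])
  have hball : ∀ w, dist x w ≤ dist x y → dist x (t w) ≤ dist x y := fun w hw =>
    dist_trans hw (htd w).le
  -- Translate by `x ^^^ y` inside the ball about `x` that just reaches `y`, and fix everything
  -- outside.
  let f : Fin (2 ^ k) → Fin (2 ^ k) := fun w => if dist x w ≤ dist x y then t w else w
  have hf : Function.Involutive f := fun w => by
    by_cases hw : dist x w ≤ dist x y
    · simp only [f, if_pos hw, if_pos (hball w hw), htt]
    · simp only [f, if_neg hw]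
  have key : ∀ v w, dist x v ≤ dist x y → dist x y < dist x w → dist (t v) w = dist v w := by
    intro v w hv hw
    rw [dist_eq_of_lt (lt_of_le_of_lt hv hw), dist_eq_of_lt (lt_of_le_of_lt (hball v hv) hw)]
  refine ⟨hf.toPerm f, fun v w => ?_, ?_, ?_, fun z hz => ?_⟩
  · change dist (f v) (f w) = dist v w
    by_cases hv : dist x v ≤ dist x y <;> by_cases hw : dist x w ≤ dist x y
    · simp only [f, if_pos hv, if_pos hw, htiso]
    · simp only [f, if_pos hv, if_neg hw]
      exact key v w hv (not_le.1 hw)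
    · simp only [f, if_neg hv, if_pos hw]
      rw [dist_comm, key w v hw (not_le.1 hv), dist_comm]
    · simp only [f, if_neg hv, if_neg hw]
  · change f x = y
    simp [f, htx]
  · change f y = x
    simp only [f, le_refl, if_true]
    rw [← htx, htt]
  · change f z = z
    simp only [f, if_neg (not_le.2 hz)]

end Isometries

/-! ### Invariant models and Pascal's triangle modulo 2. -/

section InvariantTrees

variable {k : ℕ} {R : Fin (2 ^ k) → Fin (2 ^ k) → Fin (2 ^ k) → Prop}

/-- The relation `R` describes the full binary tree: its apexes are those of the tree. -/
def DescribesTree (R : Fin (2 ^ k) → Fin (2 ^ k) → Fin (2 ^ k) → Prop) : Prop :=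
  ∀ x y z, Apex R z x y ↔ x ≠ y ∧ dist x y < dist x z

/-- If `x` were the apex, then `R x y z`, and swapping `x` and `y` gives `R y x z`, which
`not_rel_of_apex` forbids; likewise for `y`. -/
lemma IsPascalTree.apex_of_invariant (h : IsPascalTree R)
    (hinv : ∀ g ∈ isometries k, ∀ x y z, R (g x) (g y) (g z) ↔ R x y z)
    {x y z : Fin (2 ^ k)} (hxy : x ≠ y) (hd : dist x y < dist x z) : Apex R z x y := by
  obtain ⟨g, hg, hgx, hgy, hgz⟩ := exists_isometry_swap x y
  have hz := hgz z hd
  have hxz : x ≠ z := by rintro rfl; simp at hd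
  have hyz : y ≠ z := by rintro rfl; exact lt_irrefl _ hd
  have h₁ := hinv g hg x z y
  have h₂ := hinv g hg x y z
  rw [hgx, hgy, hz] at h₁ h₂
  rcases h.exists_apex x y z hxy hyz hxz with h₃ | h₃ | h₃
  · exact absurd (h₂.2 h₃.1) (h.not_rel_of_apex _ _ _ h₃)
  · exact absurd (h₂.1 h₃.1) (h.not_rel_of_apex _ _ _ h₃)
  · exact h₃

lemma IsPascalTree.describesTree (h : IsPascalTree R)
    (hinv : ∀ g ∈ isometries k, ∀ x y z, R (g x) (g y) (g z) ↔ R x y z) :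
    DescribesTree R := by
  refine fun x y z => ⟨fun ha => ?_, fun ⟨hxy, hd⟩ => h.apex_of_invariant hinv hxy hd⟩
  have hxy : x ≠ y := by rintro rfl; exact (h.degenerate x z).2.2 ha.1
  have hzy : z ≠ y := by rintro rfl; exact (h.degenerate z x).2.1 ha.1
  have hzx : z ≠ x := by rintro rfl; exact (h.degenerate z y).1 ha.1
  refine ⟨hxy, ?_⟩
  rcases dist_trichotomy z hxy with h₁ | h₁ | h₁
  · exact h₁
  · have h₂ := h.apex_of_invariant hinv hzy.symm h₁
    exact absurd ha.1 (h.not_rel_of_apex _ _ _ ⟨h₂.2, h₂.1⟩)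
  · have h₂ := h.apex_of_invariant hinv hzx.symm h₁
    exact absurd ha.2 (h.not_rel_of_apex _ _ _ ⟨h₂.2, h₂.1⟩)

/-- Every value up to `k` occurs as a distance from `x`, so consecutive levels differ by exactly
one. -/
lemma DescribesTree.succ_iff (h : DescribesTree R) (x y z : Fin (2 ^ k)) :
    Succ R x y z ↔ x ≠ y ∧ dist x z = dist x y + 1 := by
  simp only [Succ, h x _ _]
  constructor
  · rintro ⟨⟨hxy, hd⟩, hw⟩
    refine ⟨hxy, ?_⟩
    by_contra hne
    obtain ⟨w, hw'⟩ := exists_dist_eq x (i := dist x y + 1) (by have := dist_le x z; omega)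
    refine hw w ⟨⟨hxy, by omega⟩, ?_, by omega⟩
    exact dist_pos.1 (by omega)
  · rintro ⟨hxy, hd⟩
    exact ⟨⟨hxy, by omega⟩, fun w => by omega⟩

lemma odd_choose_succ (i j : ℕ) :
    Odd ((i + 1).choose (j + 1)) ↔ ¬(Odd (i.choose j) ↔ Odd (i.choose (j + 1))) := by
  rw [Nat.choose_succ_succ, Nat.odd_add, ← Nat.not_odd_iff_even]
  tauto

/-- Induction on the row `dist x z`. The axiom `pascal` is Pascal's rule modulo 2, and its universal
quantifier and implication hold vacuously on the two edges of the triangle, supplying the entries 1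
there. -/
lemma IsPascalTree.rel_iff_odd (h : IsPascalTree R) (ht : DescribesTree R)
    {x y z : Fin (2 ^ k)} (hxy : x ≠ y) (hd : dist x y < dist x z) :
    R x y z ↔ Odd ((dist x z).choose (dist x y)) := by
  induction hi : dist x z generalizing y z with
  | zero => omega
  | succ i ih =>
    have hj := dist_pos.2 hxy
    obtain ⟨i', hi'⟩ := exists_dist_eq x (i := i) (by have := dist_le x z; omega)
    have hxi : x ≠ i' := dist_pos.1 (by omega)
    rw [h.pascal x i' z y ((ht.succ_iff _ _ _).2 ⟨hxi, by omega⟩) ((ht _ _ _).2 ⟨hxy, hd⟩)]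
    obtain ⟨j, hj'⟩ := Nat.exists_eq_succ_of_ne_zero hj.ne'
    rw [hj', odd_choose_succ]
    refine not_congr (iff_congr ?_ ?_)
    · simp only [ht.succ_iff]
      rcases Nat.eq_zero_or_pos j with rfl | hjpos
      · simp only [Nat.choose_zero_right, odd_one, iff_true]
        rintro j' ⟨h₁, h₂⟩
        have := dist_pos.2 h₁
        omega
      · constructor
        · intro h₁
          obtain ⟨j', hj₂⟩ := exists_dist_eq x (i := j) (by have := dist_le x z; omega)
          have hxj : x ≠ j' := dist_pos.1 (by omega)
          have := (ih hxj (z := i') (by omega) hi').1 (h₁ j' ⟨hxj, by omega⟩)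
          rwa [hj₂] at this
        · rintro h₁ j' ⟨hxj, h₂⟩
          rw [ih hxj (by omega) hi', show dist x j' = j by omega]
          exact h₁
    · rw [ht]
      rcases lt_or_eq_of_le (show j + 1 ≤ i by omega) with h₁ | h₁
      · rw [← Nat.succ_eq_add_one, ← hj', ← ih hxy (z := i') (by omega) hi']
        exact ⟨fun h₂ => h₂ ⟨hxy, by omega⟩, fun h₂ _ => h₂⟩
      -- Right edge: `y` and `i'` are equally far from `x`, so the apex premise fails.
      · subst h₁
        simp only [Nat.choose_self, odd_one, iff_true]
        intro h₂
        omega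

lemma IsPascalTree.even_choose (h : IsPascalTree R) (ht : DescribesTree R) {j : ℕ}
    (hj : 0 < j) (hjk : j < k) : Even (k.choose j) := by
  let x : Fin (2 ^ k) := ⟨0, by positivity⟩
  obtain ⟨i, hi⟩ := exists_dist_eq x le_rfl
  -- With `i` at the maximal distance `k`, no leaf lies beyond it, so `last_row` applies.
  obtain ⟨y, hy⟩ := exists_dist_eq x hjk.le
  have hxy : x ≠ y := dist_pos.1 (by omega)
  have h₁ := h.last_row x i (fun w hw => by
    have := ((ht _ _ _).1 hw).2
    have := dist_le x w
    omega) y ((ht _ _ _).2 ⟨hxy, by omega⟩)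
  rwa [h.rel_iff_odd ht hxy (by omega), hi, hy, Nat.not_odd_iff_even] at h₁

/-- The tree relation decorated with Pascal's triangle modulo two. -/
def pascalTree (k : ℕ) : Set (Fin 3 → Fin (2 ^ k)) :=
  {t | (t 1 ≠ t 2 ∧ dist (t 1) (t 2) < dist (t 1) (t 0)) ∨
    (t 0 ≠ t 1 ∧ dist (t 0) (t 1) < dist (t 0) (t 2) ∧
      Odd ((dist (t 0) (t 2)).choose (dist (t 0) (t 1))))}

lemma rel_pascalTree (x y z : Fin (2 ^ k)) :
    rel (pascalTree k) x y z ↔ (y ≠ z ∧ dist y z < dist y x) ∨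
      (x ≠ y ∧ dist x y < dist x z ∧ Odd ((dist x z).choose (dist x y))) := Iff.rfl

lemma IsPascalTree.eq_pascalTree {A : Set (Fin 3 → Fin (2 ^ k))} (h : IsPascalTree (rel A))
    (ht : DescribesTree (rel A)) : A = pascalTree k := by
  have key : ∀ x y z, rel A x y z ↔ rel (pascalTree k) x y z := by
    intro x y z
    rw [rel_pascalTree]
    constructor
    · intro hr
      have hxy : x ≠ y := by rintro rfl; exact (h.degenerate x z).1 hr
      have hyz : y ≠ z := by rintro rfl; exact (h.degenerate y x).2.2 hr
      have hxz : x ≠ z := by rintro rfl; exact (h.degenerate x y).2.1 hr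
      rcases dist_trichotomy z hxy with h₁ | h₁ | h₁
      · exact Or.inr ⟨hxy, h₁, (h.rel_iff_odd ht hxy h₁).1 hr⟩
      · exact Or.inl ⟨hyz, h₁⟩
      · exact absurd hr (h.not_rel_of_apex _ _ _ ((ht _ _ _).2 ⟨hxz, h₁⟩))
    · rintro (h₁ | ⟨h₁, h₂, h₃⟩)
      · exact ((ht _ _ _).2 h₁).1
      · exact (h.rel_iff_odd ht h₁ h₂).2 h₃
  ext t
  have ht' : t = ![t 0, t 1, t 2] := by
    funext i
    fin_cases i <;> rfl
  rw [ht']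
  exact key _ _ _

lemma describesTree_pascalTree (k : ℕ) : DescribesTree (rel (pascalTree k)) := by
  intro x y z
  rw [Apex, rel_pascalTree, rel_pascalTree]
  constructor
  · rintro ⟨h₁ | h₁, h₂⟩
    · exact h₁
    · have h₃ := dist_eq_of_lt h₁.2.1
      rcases h₂ with h₂ | h₂
      · have := dist_eq_of_lt h₂.2
        have := dist_comm x z
        have := dist_comm y z
        have := dist_comm x y
        have := h₁.2.1
        have := h₂.2
        omega
      · have := h₁.2.1
        have := h₂.2.1
        omega
  · rintro ⟨hxy, hd⟩
    refine ⟨Or.inl ⟨hxy, hd⟩, Or.inl ⟨hxy.symm, ?_⟩⟩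
    rw [dist_comm y x, dist_eq_of_lt hd]
    exact hd

lemma rel_pascalTree_iff {x y z : Fin (2 ^ k)} (hxy : x ≠ y) (hd : dist x y < dist x z) :
    rel (pascalTree k) x y z ↔ Odd ((dist x z).choose (dist x y)) := by
  rw [rel_pascalTree]
  refine ⟨?_, fun h => Or.inr ⟨hxy, hd, h⟩⟩
  rintro (⟨_, h₁⟩ | ⟨_, _, h₁⟩)
  · have := dist_eq_of_lt hd
    have := dist_comm x y
    omega
  · exact h₁

lemma isPascalTree_pascalTree (hk : ∀ j, 0 < j → j < k → Even (k.choose j)) :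
    IsPascalTree (rel (pascalTree k)) := by
  have ht := describesTree_pascalTree k
  refine ⟨fun x y => ?_, fun x y z hxy hyz hxz => ?_, fun x y z ha => ?_,
    fun x i' i j hs ha => ?_, fun x i hi j ha => ?_⟩
  · simp only [rel_pascalTree, dist_self, dist_comm y x]
    refine ⟨?_, ?_, ?_⟩ <;> simp
  · simp only [ht _ _ _]
    rcases dist_trichotomy z hxy with h₁ | h₁ | h₁
    · exact Or.inr (Or.inr ⟨hxy, h₁⟩)
    · exact Or.inl ⟨hyz, h₁⟩
    · exact Or.inr (Or.inl ⟨hxz, h₁⟩)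
  · obtain ⟨hyz, hd⟩ := (ht _ _ _).1 ha
    have h₁ := dist_eq_of_lt hd
    have := dist_comm x y
    have := dist_comm x z
    have := dist_comm y z
    rw [rel_pascalTree]
    rintro (⟨_, h₂⟩ | ⟨_, h₂, _⟩) <;> omega
  · obtain ⟨hxi, hi⟩ := (ht.succ_iff _ _ _).1 hs
    obtain ⟨hxj, hj⟩ := (ht _ _ _).1 ha
    obtain ⟨j₀, hj₀⟩ := Nat.exists_eq_succ_of_ne_zero (dist_pos.2 hxj).ne'
    rw [rel_pascalTree_iff hxj hj, hi, hj₀, odd_choose_succ]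
    refine not_congr (iff_congr ?_ ?_)
    · simp only [ht.succ_iff]
      constructor
      · rintro h₁ j' ⟨h₂, h₃⟩
        rw [rel_pascalTree_iff h₂ (by omega), show dist x j' = j₀ by omega]
        exact h₁
      · intro h₁
        rcases Nat.eq_zero_or_pos j₀ with rfl | hpos
        · simp
        · obtain ⟨j', hj'⟩ := exists_dist_eq x (i := j₀) (by have := dist_le x i; omega)
          have hxj' : x ≠ j' := dist_pos.1 (by omega)
          have := h₁ j' ⟨hxj', by omega⟩
          rwa [rel_pascalTree_iff hxj' (by omega), hj'] at this
    · rw [ht]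
      constructor
      · rintro h₁ ⟨_, h₂⟩
        rw [rel_pascalTree_iff hxj h₂, hj₀]
        exact h₁
      · intro h₁
        rcases lt_or_eq_of_le (show j₀ + 1 ≤ dist x i' by omega) with h₂ | h₂
        · have h₃ : dist x j < dist x i' := by omega
          have := h₁ ⟨hxj, h₃⟩
          rwa [rel_pascalTree_iff hxj h₃, hj₀] at this
        · rw [← h₂, Nat.choose_self]
          exact odd_one
  · obtain ⟨hxj, hj⟩ := (ht _ _ _).1 ha
    have hxi : x ≠ i := dist_pos.1 (by omega)
    have hik : dist x i = k := by
      by_contra hne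
      obtain ⟨w, hw⟩ := exists_dist_eq x le_rfl
      exact hi w ((ht _ _ _).2 ⟨hxi, by have := dist_le x i; omega⟩)
    rw [rel_pascalTree_iff hxj hj, hik, Nat.not_odd_iff_even]
    exact hk _ (dist_pos.2 hxj) (by omega)

end InvariantTrees

/-! ### Counting modulo 2 by fixed points. -/

section Counting

variable {k : ℕ}

/-- The structures on `Fin (2 ^ k)` satisfying the sentence. -/
abbrev Model (k : ℕ) : Type := {A : Set (Fin 3 → Fin (2 ^ k)) // IsPascalTree (rel A)}

lemma IsPascalTree.comap {M N : Type} {R : M → M → M → Prop} (h : IsPascalTree R) (e : N ≃ M) :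
    IsPascalTree fun x y z => R (e x) (e y) (e z) := by
  have hs : ∀ x y z, Succ (fun x y z => R (e x) (e y) (e z)) x y z ↔
      Succ R (e x) (e y) (e z) := fun x y z =>
    and_congr Iff.rfl (e.forall_congr_right
      (q := fun w => ¬(Apex R w (e x) (e y) ∧ Apex R (e z) (e x) w)))
  refine ⟨fun x y => h.degenerate _ _, fun x y z h₁ h₂ h₃ => h.exists_apex _ _ _
    (e.injective.ne h₁) (e.injective.ne h₂) (e.injective.ne h₃),
    fun x y z => h.not_rel_of_apex _ _ _, fun x i' i j h₁ h₂ => ?_, fun x i hi j => ?_⟩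
  · refine (h.pascal _ _ _ _ ((hs _ _ _).1 h₁) h₂).trans (not_congr (iff_congr ?_ Iff.rfl))
    simp only [hs]
    exact (e.forall_congr_right
      (q := fun j' => Succ R (e x) j' (e j) → R (e x) j' (e i'))).symm
  · exact h.last_row _ _ ((e.forall_congr_right (q := fun w => ¬Apex R w (e x) (e i))).1 hi) _

instance : MulAction (isometries k) (Model k) where
  smul g A := ⟨{t | (fun i => (g⁻¹).1 (t i)) ∈ A.1}, by
    convert A.2.comap (g⁻¹).1 using 4 with x y z
    unfold rel
    rw [Set.mem_ofPred_eq]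
    congr! 1
    funext i
    fin_cases i <;> rfl⟩
  one_smul A := rfl
  mul_smul g h A := Subtype.ext (Set.ext fun t => by
    change (fun i => ((g * h)⁻¹).1 (t i)) ∈ A.1 ↔ (fun i => (h⁻¹).1 ((g⁻¹).1 (t i))) ∈ A.1
    rw [mul_inv_rev]
    rfl)

lemma mem_smul_model (g : isometries k) (A : Model k) (t : Fin 3 → Fin (2 ^ k)) :
    t ∈ (g • A).1 ↔ (fun i => (g⁻¹).1 (t i)) ∈ A.1 := Iff.rfl

lemma describesTree_of_mem_fixedPoints {A : Model k}
    (hA : A ∈ MulAction.fixedPoints (isometries k) (Model k)) : DescribesTree (rel A.1) := by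
  refine A.2.describesTree fun g hg x y z => ?_
  have h₁ : (⟨g, hg⟩ : isometries k)⁻¹ • A = A := hA _
  have h₂ := mem_smul_model (⟨g, hg⟩ : isometries k)⁻¹ A ![x, y, z]
  rw [h₁, inv_inv] at h₂
  refine Iff.trans ?_ h₂.symm
  unfold rel
  congr! 1
  funext i
  fin_cases i <;> rfl

lemma countingFunction_eq (k : ℕ) :
    countingFunction pascalSentence (2 ^ k) = Nat.card (Model k) := by
  rw [countingFunction, ← Nat.card_coe_set_eq]
  simp only [realize_pascalSentence]
  rfl

lemma countingFunction_modEq (k : ℕ) :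
    countingFunction pascalSentence (2 ^ k) ≡
      Nat.card (MulAction.fixedPoints (isometries k) (Model k)) [MOD 2] := by
  have : Fact (Nat.Prime 2) := ⟨Nat.prime_two⟩
  rw [countingFunction_eq]
  exact (isPGroup_isometries k).card_modEq_card_fixedPoints _

lemma odd_countingFunction_iff (k : ℕ) :
    Odd (countingFunction pascalSentence (2 ^ k)) ↔
      ∀ j, 0 < j → j < k → Even (k.choose j) := by
  have hmod := countingFunction_modEq k
  constructor
  · intro hodd j hj hjk
    by_contra hne
    have : IsEmpty (MulAction.fixedPoints (isometries k) (Model k)) := ⟨fun A =>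
      hne (A.1.2.even_choose (describesTree_of_mem_fixedPoints A.2) hj hjk)⟩
    rw [Nat.card_of_isEmpty] at hmod
    rw [Nat.odd_iff] at hodd
    rw [Nat.ModEq, hodd] at hmod
    omega
  · intro hk
    have : Nat.card (MulAction.fixedPoints (isometries k) (Model k)) = 1 := by
      rw [Nat.card_eq_one_iff_unique]
      refine ⟨⟨fun A B => Subtype.ext (Subtype.ext ?_)⟩,
        ⟨⟨⟨pascalTree k, isPascalTree_pascalTree hk⟩, fun g => Subtype.ext (Set.ext fun t => ?_)⟩⟩⟩
      · rw [A.1.2.eq_pascalTree (describesTree_of_mem_fixedPoints A.2),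
          B.1.2.eq_pascalTree (describesTree_of_mem_fixedPoints B.2)]
      · have hd : ∀ x y, dist ((g⁻¹).1 x) ((g⁻¹).1 y) = dist x y := (g⁻¹).2
        rw [mem_smul_model]
        simp only [pascalTree, Set.mem_ofPred_eq, hd, (Equiv.injective _).ne_iff]
    rw [this] at hmod
    rw [Nat.odd_iff]
    exact hmod

end Counting

/-! ### From parities to non-periodicity. -/

section Periodicity

/-- In Vandermonde's sum only the term with `(2 ^ m).choose 0` is odd. -/
lemma odd_choose_two_pow_add {m r : ℕ} (hr : r < 2 ^ m) : Odd ((2 ^ m + r).choose r) := by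
  rw [Nat.add_choose_eq, Finset.Nat.sum_antidiagonal_eq_sum_range_succ
    (fun i j : ℕ => Nat.choose (2 ^ m) i * r.choose j), Nat.succ_eq_add_one, Finset.sum_range_succ',
    Nat.odd_add']
  simp only [Nat.choose_zero_right, Nat.sub_zero, Nat.choose_self,
    mul_one, odd_one, true_iff]
  refine Finset.even_sum _ fun i hi => Even.mul_right ?_ _
  rw [Finset.mem_range] at hi
  exact even_iff_two_dvd.2 (Nat.prime_two.dvd_choose_pow (by omega) (by omega))

lemma exists_two_pow_modEq {p : ℕ} (hp : 0 < p) :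
    ∃ r a, 0 < r ∧ ∀ k ≥ a, ∃ t, 2 ^ (k + r) = 2 ^ k + p * t := by
  obtain ⟨a, q, hq, rfl⟩ := Nat.exists_eq_two_pow_mul_odd hp.ne'
  -- Euler's theorem handles the odd part `q` of `p`; `k ≥ a` absorbs the power of two.
  refine ⟨q.totient, a, Nat.totient_pos.2 hq.pos, fun k hk => ?_⟩
  have h₁ : 2 ^ q.totient ≡ 1 [MOD q] :=
    Nat.ModEq.pow_totient (Nat.coprime_two_left.2 hq)
  obtain ⟨t, ht⟩ := (Nat.modEq_iff_dvd' (Nat.one_le_two_pow)).1 h₁.symm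
  have h₂ : 2 ^ q.totient = 1 + q * t := by
    have : 1 ≤ 2 ^ q.totient := Nat.one_le_two_pow
    omega
  obtain ⟨b, rfl⟩ := Nat.exists_eq_add_of_le hk
  refine ⟨2 ^ b * t, ?_⟩
  rw [pow_add, h₂, pow_add]
  ring

lemma not_ultimatelyPeriodicMod_two :
    ¬UltimatelyPeriodicMod 2 (countingFunction pascalSentence) := by
  rintro ⟨p, N, hp, h⟩
  obtain ⟨r, a, hr, ht⟩ := exists_two_pow_modEq hp
  -- This makes `2 ^ m` exceed `a`, `N` and `r` at once.
  set m := a + N + r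
  have hm : m < 2 ^ m := Nat.lt_two_pow_self
  obtain ⟨t, ht⟩ := ht (2 ^ m) (by omega)
  have hN : N ≤ 2 ^ 2 ^ m := by
    have : 2 ^ m < 2 ^ 2 ^ m := Nat.lt_two_pow_self
    omega
  have hmul : ∀ t, countingFunction pascalSentence (2 ^ 2 ^ m + p * t) ≡
      countingFunction pascalSentence (2 ^ 2 ^ m) [MOD 2] := by
    intro t
    induction t with
    | zero => rfl
    | succ t ih =>
      rw [mul_add, mul_one, ← add_assoc]
      exact (h _ (by omega)).trans ih
  have h₁ : Odd (countingFunction pascalSentence (2 ^ 2 ^ m)) :=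
    (odd_countingFunction_iff _).2 fun j hj hjm =>
      even_iff_two_dvd.2 (Nat.prime_two.dvd_choose_pow (by omega) (by omega))
  have h₂ : Odd (countingFunction pascalSentence (2 ^ (2 ^ m + r))) := by
    rw [ht, Nat.odd_iff, hmul t, ← Nat.odd_iff]
    exact h₁
  have h₃ := (odd_countingFunction_iff _).1 h₂ r hr (by omega)
  exact Nat.not_even_iff_odd.2 (odd_choose_two_pow_add (by omega)) h₃

end Periodicity

end TernaryTree

/-- Windows of length `E.order` take finitely many values modulo `m`, so two coincide; the
recurrence then makes the two shifted sequences equal. -/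
lemma MCFinite.ultimatelyPeriodicMod {s : ℕ → ℕ} (hs : MCFinite s) {m : ℕ} (hm : 0 < m) :
    UltimatelyPeriodicMod m s := by
  have : NeZero m := ⟨hm.ne'⟩
  obtain ⟨r, E, hE⟩ := hs m hm
  have hshift : ∀ c, E.IsSolution fun n => (s (r + (n + c)) : ZMod m) := fun c n => by
    have := hE (n + c)
    simp only at this ⊢
    rw [show n + E.order + c = n + c + E.order by ring, this]
    exact Finset.sum_congr rfl fun i _ => by rw [show n + c + i = n + i + c by ring]
  obtain ⟨a, b, hab, heq⟩ := Finite.exists_ne_map_eq_of_infinite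
    fun (c : ℕ) (i : Fin E.order) => (s (r + (i + c)) : ZMod m)
  wlog hlt : a < b generalizing a b
  · exact this b a hab.symm heq.symm (by omega)
  refine ⟨b - a, r + a, by omega, fun n hn => ?_⟩
  have h₁ : (fun n => (s (r + (n + a)) : ZMod m)) = fun n => (s (r + (n + b)) : ZMod m) := by
    refine (E.eq_mk_of_is_sol_of_eq_init' (hshift a) fun i => rfl).trans
      (E.eq_mk_of_is_sol_of_eq_init' (hshift b) fun i => ?_).symm
    exact (congrFun heq i).symm
  have h₂ := congrFun h₁ (n - (r + a))
  rw [show r + (n - (r + a) + a) = n by omega,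
    show r + (n - (r + a) + b) = n + (b - a) by omega] at h₂
  exact ((ZMod.natCast_eq_natCast_iff _ _ _).1 h₂).symm

theorem mainTheorem3 :
    ∃ φ : ternaryLanguage.Sentence,
      ¬ UltimatelyPeriodicMod 2 (countingFunction φ) ∧ ¬ MCFinite (countingFunction φ) :=
  ⟨TernaryTree.pascalSentence, TernaryTree.not_ultimatelyPeriodicMod_two, fun h =>
    TernaryTree.not_ultimatelyPeriodicMod_two (h.ultimatelyPeriodicMod two_pos)⟩
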